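/- **Setting.** In the red-blue pebble game on a finite directed acyclic graph, the input vertices (no predecessor) initially carry blue pebbles. A move places a red pebble on a vertex carrying a blue one (load), places a blue pebble on a vertex carrying a red one (store), places a red pebble on a non-input vertex all of whose immediate predecessors carry red pebbles (compute), or removes a pebble. At most $S$ red pebbles may be on the graph at any time. A calculation is complete when all output vertices (no successor) carry blue pebbles; its number $Q$ of I/O operations is the number of loads and stores. Recomputation is allowed. Let $e,r,W_{out},H_{out},C_{out},C_{in}\ge 1$ with $e\mid W_{out}$, $e\mid H_{out}$ and $\tfrac12\le r/e\le 2$. The Winograd algorithm $F(e\times e,r\times r)$ (stride one) takes as inputs an image of size $(W_{out}+r-1)\times(H_{out}+r-1)\times C_{in}$ and $C_{out}$ kernels $K_k$ of size $r\times r\times C_{in}$. For each of the $W_{out}H_{out}/e^2$ output tiles $i$ of size $e\times e$, with input window $I_i$ of size $(e+r-1)\times(e+r-1)\times C_{in}$, and each kernel $k$, it performs four steps: 1. in each input channel, every entry of the $(e+r-1)\times(e+r-1)$ arrays $P_i$ and $J_k$ is formed as a linear combination of all $(e+r-1)^2$ entries of $I_i$, respectively of all $r^2$ entries of $K_k$,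 in that channel; 2. $\Lambda_{i,k}=P_i\odot J_k$ is formed entrywise; 3. $\Lambda_{i,k}$ is summed over the $C_{in}$ input channels, giving an $(e+r-1)\times(e+r-1)$ matrix $\Pi_{i,k}$; 4. each of the $e^2$ outputs of tile $i$ in output channel $k$ is formed as a linear combination of all $(e+r-1)^2$ entries of $\Pi_{i,k}$. The coefficients of the transformation matrices stay in fast memory and are not vertices. A linear combination of $m$ arguments multiplies each argument by its coefficient ($m$ vertices) and adds up the products by $m-1$ binary additions along an arbitrary binary tree; a sum over channels likewise uses $C_{in}-1$ binary additions along an arbitrary binary tree. No tree shares vertices with another one. **Theorem.** (a) Consider the graph in which all blocks of $e^2$ outputs are generated independently, so that every pair $(i,k)$ of a tile and a kernel has its own copies of the trees for $P_i$ and $J_k$. There is an absolute constant $c>0$ such that, for all parameters as above, all choices of trees and all $S\ge1$, every complete calculation on this graph with at most $S$ red pebbles satisfies $$Q\;\ge\; c\,\frac{W_{out}H_{out}C_{out}C_{in}\,(e+r-1)\,r}{e\sqrt S}.$$ (b) Consider the graph in which each $P_i$ and each $J_k$ is computed by one set of trees, used by all pairs $(i,k)$. For all $e,r$ there is a constant $c_{e,r}>0$,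 depending only on $e$ and $r$, such that the same inequality with $c_{e,r}$ in place of $c$ holds for all $W_{out},H_{out},C_{out},C_{in}$ as above, all choices of trees, all $S\ge1$ and every complete calculation on this graph with at most $S$ red pebbles. -/

import Mathlib

/-! ### The red-blue pebble game on a directed graph -/

namespace PebbleGame

/-- The input vertices: those without an immediate predecessor. -/
def inputs {V : Type} (G : Digraph V) : Set V := {v | ∀ u, ¬ G.Adj u v}

/-- The output vertices: those without an immediate successor. -/
def outputs {V : Type} (G : Digraph V) : Set V := {v | ∀ u, ¬ G.Adj v u}

/-- A configuration: the vertices carrying a red pebble (fast memory) and those carrying a blue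
pebble (slow memory). -/
structure Config (V : Type) where
  red : Set V
  blue : Set V

/-- One move of the game with at most `S` red pebbles; the last argument is the number of
I/O operations of the move (one for a load or a store, none otherwise). Input vertices cannot be
computed: their values are only available in slow memory. -/
inductive Move {V : Type} (G : Digraph V) (S : ℕ) : Config V → Config V → ℕ → Prop
  | load (s : Config V) (v : V) (hv : v ∈ s.blue) (hS : (insert v s.red).encard ≤ S) :
      Move G S s ⟨insert v s.red, s.blue⟩ 1
  | store (s : Config V) (v : V) (hv : v ∈ s.red) :
      Move G S s ⟨s.red, insert v s.blue⟩ 1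
  | compute (s : Config V) (v : V) (hin : v ∉ inputs G) (hv : ∀ u, G.Adj u v → u ∈ s.red)
      (hS : (insert v s.red).encard ≤ S) :
      Move G S s ⟨insert v s.red, s.blue⟩ 0
  | freeRed (s : Config V) (v : V) : Move G S s ⟨s.red \ {v}, s.blue⟩ 0
  | freeBlue (s : Config V) (v : V) : Move G S s ⟨s.red, s.blue \ {v}⟩ 0

/-- `Reach G S s q`: the configuration `s` can be reached with exactly `q` I/O operations from the
initial configuration, in which there are blue pebbles on the inputs and no other pebbles. -/
inductive Reach {V : Type} (G : Digraph V) (S : ℕ) : Config V → ℕ → Prop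
  | start : Reach G S ⟨∅, inputs G⟩ 0
  | move {s t : Config V} {q d : ℕ} (hs : Reach G S s q) (hm : Move G S s t d) :
      Reach G S t (q + d)

/-- There is a complete calculation (one that ends with blue pebbles on all outputs) on `G` with at
most `S` red pebbles and exactly `q` I/O operations. -/
def CompleteCalculation {V : Type} (G : Digraph V) (S q : ℕ) : Prop :=
  ∃ s : Config V, Reach G S s q ∧ outputs G ⊆ s.blue

end PebbleGame

/-! ### Summation trees -/

/-- Binary trees with labelled leaves. -/
inductive BinTree (α : Type) : Type
  | leaf (a : α) : BinTree α
  | node (l r : BinTree α) : BinTree α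

namespace BinTree

def leaves {α : Type} : BinTree α → List α
  | leaf a => [a]
  | node l r => l.leaves ++ r.leaves

/-- The set of all subtrees of a tree (itself included). -/
def subtrees {α : Type} : BinTree α → Set (BinTree α)
  | leaf a => {leaf a}
  | node l r => insert (node l r) (l.subtrees ∪ r.subtrees)

/-- `s` is one of the two immediate subtrees of `t`. -/
def IsChild {α : Type} (s t : BinTree α) : Prop := ∃ u, t = node s u ∨ t = node u s

end BinTree

/-- A way of adding up one term for every element of `α`, two summands at a time: a binary tree in
which every element of `α` labels exactly one leaf. -/
structure SumTree (α : Type) where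
  tree : BinTree α
  nodup : tree.leaves.Nodup
  mem_leaves : ∀ a, a ∈ tree.leaves

/-- The vertices of a summation tree. As the leaf labels are distinct, a vertex can be identified
with the subtree below it. -/
def SumTree.Vertex {α : Type} (t : SumTree α) : Type := {s : BinTree α // s ∈ t.tree.subtrees}

/-! ### The directed acyclic graph of the Winograd algorithm -/

namespace Winograd

/-- The sizes of a convolution (with stride one) performed with `F(e × e, r × r)`: the output image
is `Wout × Hout × Cout`, there are `Cout` kernels of size `r × r × Cin`, and the input image is
`(Wout + r - 1) × (Hout + r - 1) × Cin`. -/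
structure Params where
  e : ℕ
  r : ℕ
  Wout : ℕ
  Hout : ℕ
  Cout : ℕ
  Cin : ℕ

/-- The side length of the windows and of the transformed tiles. -/
abbrev Params.n (w : Params) : ℕ := w.e + w.r - 1

/-- All sizes are positive, the output image is cut into whole `e × e` tiles, and
`1/2 ≤ r/e ≤ 2`. -/
structure Params.Admissible (w : Params) : Prop where
  e_pos : 0 < w.e
  r_pos : 0 < w.r
  Wout_pos : 0 < w.Wout
  Hout_pos : 0 < w.Hout
  Cout_pos : 0 < w.Cout
  Cin_pos : 0 < w.Cin
  e_dvd_Wout : w.e ∣ w.Wout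
  e_dvd_Hout : w.e ∣ w.Hout
  half_le : (1 / 2 : ℝ) ≤ (w.r : ℝ) / (w.e : ℝ)
  le_two : (w.r : ℝ) / (w.e : ℝ) ≤ 2

/-- The positions of the `e × e` tiles in one channel of the output image. -/
abbrev Params.Tile (w : Params) : Type := Fin (w.Wout / w.e) × Fin (w.Hout / w.e)

/-- The positions in a window, or in a transformed tile. -/
abbrev Params.Pos (w : Params) : Type := Fin w.n × Fin w.n

/-- The shapes of all trees in the algorithm. The transform of the input window of tile `i` is
carried out in a family `κ` of copies, that of the `k`-th kernel in a family `ν` of copies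
(the two choices of interest are at the end). -/
structure Trees (w : Params) (κ ν : Type) where
  /-- for the entry `p` of the transformed input window of tile `i` in the input channel `c` -/
  inT : w.Tile → κ → Fin w.Cin → w.Pos → SumTree w.Pos
  /-- for the entry `p` of the transform of the `k`-th kernel in the input channel `c` -/
  kerT : Fin w.Cout → ν → Fin w.Cin → w.Pos → SumTree (Fin w.r × Fin w.r)
  /-- for the sum over the input channels at entry `p`, for tile `i` and kernel `k` -/
  sumT : w.Tile → Fin w.Cout → w.Pos → SumTree (Fin w.Cin)
  /-- for the entry `q` of the `e × e` outputs of tile `i` in output channel `k` -/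
  outT : w.Tile → Fin w.Cout → Fin w.e × Fin w.e → SumTree w.Pos

/-- The vertices of the graph: the entries of the input image and of the kernels, and the vertices
of all trees. In `inT`, `kerT` and `outT`, which form linear combinations, a leaf is the product of
one argument with a coefficient of a transformation matrix (the coefficients stay in fast memory and
are not vertices), so that a linear combination of `m` arguments has `2 m - 1` vertices. In `sumT`
the leaf labelled `c` is the product of the transformed input and the transformed kernel in the
channel `c`. The vertices of a tree other than its leaves are sums of two vertices, and its root is
its result. -/
inductive Vertex (w : Params) {κ ν : Type} (T : Trees w κ ν) : Type
  | img (x : Fin (w.Wout + w.r - 1)) (y : Fin (w.Hout + w.r - 1)) (c : Fin w.Cin)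
  | ker (k : Fin w.Cout) (c : Fin w.Cin) (a : Fin w.r × Fin w.r)
  | inT (i : w.Tile) (j : κ) (c : Fin w.Cin) (p : w.Pos) (s : (T.inT i j c p).Vertex)
  | kerT (k : Fin w.Cout) (j : ν) (c : Fin w.Cin) (p : w.Pos) (s : (T.kerT k j c p).Vertex)
  | sumT (i : w.Tile) (k : Fin w.Cout) (p : w.Pos) (s : (T.sumT i k p).Vertex)
  | outT (i : w.Tile) (k : Fin w.Cout) (q : Fin w.e × Fin w.e) (s : (T.outT i k q).Vertex)

/-- The graph of the algorithm. The calculation for tile `i` and kernel `k` uses the copy `f k` of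
the transformed input window of tile `i` and the copy `g i` of the transformed kernel `k`. The
window of tile `i` has its corner at `(e * i.1, e * i.2)`. -/
def graph (w : Params) {κ ν : Type} (f : Fin w.Cout → κ) (g : w.Tile → ν) (T : Trees w κ ν) :
    Digraph (Vertex w T) where
  Adj
    -- the arguments of the linear combinations that transform windows and kernels
    | .img x y c, .inT i _ c' _ s => c = c' ∧ ∃ a : w.Pos, s.1 = .leaf a ∧
        x.1 = w.e * i.1.1 + a.1.1 ∧ y.1 = w.e * i.2.1 + a.2.1
    | .ker k c a, .kerT k' _ c' _ s => k = k' ∧ c = c' ∧ s.1 = .leaf a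
    -- the arguments of the element-wise products
    | .inT i j c p s, .sumT i' k p' s' => i = i' ∧ j = f k ∧ p = p' ∧
        s.1 = (T.inT i j c p).tree ∧ s'.1 = .leaf c
    | .kerT k j c p s, .sumT i k' p' s' => k = k' ∧ j = g i ∧ p = p' ∧
        s.1 = (T.kerT k j c p).tree ∧ s'.1 = .leaf c
    -- the arguments of the linear combinations that form the outputs
    | .sumT i k p s, .outT i' k' _ s' => i = i' ∧ k = k' ∧
        s.1 = (T.sumT i k p).tree ∧ s'.1 = .leaf p
    -- the additions inside the trees
    | .inT i j c p s, .inT i' j' c' p' s' => i = i' ∧ j = j' ∧ c = c' ∧ p = p' ∧ s.1.IsChild s'.1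
    | .kerT k j c p s, .kerT k' j' c' p' s' =>
        k = k' ∧ j = j' ∧ c = c' ∧ p = p' ∧ s.1.IsChild s'.1
    | .sumT i k p s, .sumT i' k' p' s' => i = i' ∧ k = k' ∧ p = p' ∧ s.1.IsChild s'.1
    | .outT i k q s, .outT i' k' q' s' => i = i' ∧ k = k' ∧ q = q' ∧ s.1.IsChild s'.1
    | _, _ => False

/-- The graph in which every block of `e × e` outputs is generated independently: each pair of a
tile and a kernel has its own copy of `F(e × e, r × r)`, transforms included. -/
def independentGraph (w : Params) (T : Trees w (Fin w.Cout) w.Tile) : Digraph (Vertex w T) :=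
  graph w id id T

/-- The graph in which every window and every kernel is transformed once, the result being shared by
all blocks of outputs. -/
def sharedGraph (w : Params) (T : Trees w Unit Unit) : Digraph (Vertex w T) :=
  graph w (fun _ => ()) (fun _ => ()) T

/-- `Wout Hout Cout Cin (e + r - 1) r / (e √S)`. -/
noncomputable def bound (w : Params) (S : ℕ) : ℝ :=
  (w.Wout : ℝ) * w.Hout * w.Cout * w.Cin * ((w.e : ℝ) + w.r - 1) * w.r / (w.e * √(S : ℝ))

end Winograd

/-! Cut the calculation into phases of `S` I/O operations. Let `D` be the vertices red at the start
of a phase or loaded in it, and `E` those stored in it or red at its end; each has at most `2 * S`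
elements. Whatever is red during the phase is derivable from `D` in the graph, so the order of moves
and recomputation no longer matter. Following walks back from the outputs, every vertex that feeds
an output is covered by some phase: it is derivable from `D`, and a walk of derivable vertices leads
from it into `E` (`CompleteCalculation.exists_phases`). It remains to bound how many vertices one
phase can cover.

In (b), fix one position and count the products `(i, k, c)`. Apart from those lying in `D`, each
leaves a trace of `(i, k)` in `E` and needs traces of `(i, c)` and `(k, c)` in `D`. By
Loomis–Whitney a phase covers `O(S ^ (3/2))` products (`card_products_le`).

In (a), a transform serves a single pair `(i, k)`, so a vertex of `D` inside it accounts for one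
product only; any other product needs a whole window channel and kernel channel in `D`. Pairing
output position `q` with the same position in the window gives `e²` products per `(i, k, c)`. Each
pair `(k, c)` now costs `r²` elements of `D`, which improves Loomis–Whitney by a factor `r`
(`card_independent_products_le`). This needs phases large enough to absorb the exceptional products.
If no window fits into `D`, count instead the multiplications inside the input transforms: each tree
involved meets `D` or `E`, so a phase covers only `O(S ^ 2)` of them (`card_window_products_le`). -/

namespace PebbleGame

/-! ### Splitting a calculation into phases -/

/-- The vertices that can be computed from the values of `D` alone. -/
inductive Derivable {V : Type} (G : Digraph V) (D : Set V) : V → Prop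
  | base {v : V} (hv : v ∈ D) : Derivable G D v
  | step {v : V} (hin : v ∉ inputs G) (hv : ∀ u, G.Adj u v → Derivable G D u) : Derivable G D v

theorem Derivable.mono {V : Type} {G : Digraph V} {D D' : Set V} (h : D ⊆ D') {v : V}
    (hv : Derivable G D v) : Derivable G D' v := by
  induction hv with
  | base hv => exact .base (h hv)
  | step hin _ ih => exact .step hin ih

theorem Derivable.mem_of_mem_inputs {V : Type} {G : Digraph V} {D : Set V} {v : V}
    (hv : Derivable G D v) (hin : v ∈ inputs G) : v ∈ D := by
  cases hv with
  | base hv => exact hv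
  | step hin' _ => exact absurd hin hin'

theorem Derivable.of_adj {V : Type} {G : Digraph V} {D : Set V} {u v : V}
    (hv : Derivable G D v) (hD : v ∉ D) (h : G.Adj u v) : Derivable G D u := by
  cases hv with
  | base hv => exact absurd hv hD
  | step _ hv => exact hv u h

/-- There is a walk from `v` to `w` all of whose vertices lie in `U` and can be computed
from `D`. -/
def DerivableWalk {V : Type} (G : Digraph V) (U D : Set V) (v w : V) : Prop :=
  Derivable G D v ∧
    Relation.ReflTransGen (fun a b => G.Adj a b ∧ b ∈ U ∧ Derivable G D b) v w

theorem DerivableWalk.mono {V : Type} {G : Digraph V} {U D D' : Set V} (h : D ⊆ D') {v w : V}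
    (hv : DerivableWalk G U D v w) : DerivableWalk G U D' v w :=
  ⟨hv.1.mono h, Relation.ReflTransGen.mono (fun _ _ hab => ⟨hab.1, hab.2.1, hab.2.2.mono h⟩) _ _ hv.2⟩

/-- A walk inside `U`. -/
def Walk {V : Type} (G : Digraph V) (U : Set V) : V → V → Prop :=
  Relation.ReflTransGen (fun a b => G.Adj a b ∧ a ∈ U ∧ b ∈ U)

/-- Some walk from `v` inside `U`, with all vertices computable from `D`, reaches `E`. -/
def Covered {V : Type} (G : Digraph V) (U : Set V) (P : Set V × Set V) (v : V) : Prop :=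
  ∃ w ∈ U, w ∈ P.2 ∧ DerivableWalk G U P.1 v w

theorem Move.red_encard_le {V : Type} {G : Digraph V} {S : ℕ} {s t : Config V} {d : ℕ}
    (h : Move G S s t d) (hs : s.red.encard ≤ S) : t.red.encard ≤ S := by
  cases h with
  | load v hv hS => exact hS
  | store v hv => exact hs
  | compute v hin hv hS => exact hS
  | freeRed v => exact (Set.encard_le_encard Set.sdiff_subset).trans hs
  | freeBlue v => exact hs

theorem Reach.red_encard_le {V : Type} {G : Digraph V} {S : ℕ} {s : Config V} {q : ℕ}
    (h : Reach G S s q) : s.red.encard ≤ S := by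
  induction h with
  | start => simp
  | move _ hm ih => exact hm.red_encard_le ih

/-- What is known about a configuration when the phases `L` are over and, in the current phase,
everything was computed from `D` and the vertices of `E` were stored. -/
structure Invariant {V : Type} (G : Digraph V) (L : List (Set V × Set V)) (D E : Set V)
    (s : Config V) : Prop where
  derivable : ∀ u ∈ s.red, Derivable G D u
  red : ∀ U : Set V, (∀ u ∈ U, u ∉ inputs G) → ∀ u ∈ U, u ∈ s.red → ∀ v, Walk G U v u →
    (∃ P ∈ L, Covered G U P v) ∨ DerivableWalk G U D v u
  blue : ∀ U : Set V, (∀ u ∈ U, u ∉ inputs G) → ∀ u ∈ U, u ∈ s.blue → ∀ v, Walk G U v u →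
    (∃ P ∈ L, Covered G U P v) ∨ (u ∈ E ∧ DerivableWalk G U D v u)

namespace Invariant

variable {V : Type} {G : Digraph V} {L : List (Set V × Set V)} {D E : Set V} {s : Config V}

/-- The vertices red at the boundary carry values across it, so they enter both the `E` of the old
phase and the `D` of the new one. -/
theorem close (h : Invariant G L D E s) : Invariant G ((D, E ∪ s.red) :: L) s.red ∅ s where
  derivable u hu := .base hu
  red U hU u hu hr v hv := by
    refine .inl ?_
    rcases h.red U hU u hu hr v hv with ⟨P, hP, hc⟩ | hd
    · exact ⟨P, List.mem_cons_of_mem _ hP, hc⟩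
    · exact ⟨_, List.mem_cons_self, u, hu, .inr hr, hd⟩
  blue U hU u hu hb v hv := by
    refine .inl ?_
    rcases h.blue U hU u hu hb v hv with ⟨P, hP, hc⟩ | ⟨hE, hd⟩
    · exact ⟨P, List.mem_cons_of_mem _ hP, hc⟩
    · exact ⟨_, List.mem_cons_self, u, hu, .inl hE, hd⟩

theorem load (h : Invariant G L D E s) {v : V} (hv : v ∈ s.blue) :
    Invariant G L (insert v D) E ⟨insert v s.red, s.blue⟩ where
  derivable u hu := by
    rcases hu with rfl | hu
    · exact .base (Set.mem_insert _ _)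
    · exact (h.derivable u hu).mono (Set.subset_insert _ _)
  red U hU u hu hr x hx := by
    rcases hr with rfl | hr
    · exact (h.blue U hU _ hu hv x hx).imp_right fun hd => hd.2.mono (Set.subset_insert _ _)
    · exact (h.red U hU u hu hr x hx).imp_right fun hd => hd.mono (Set.subset_insert _ _)
  blue U hU u hu hb x hx :=
    (h.blue U hU u hu hb x hx).imp_right fun hd => ⟨hd.1, hd.2.mono (Set.subset_insert _ _)⟩

theorem store (h : Invariant G L D E s) {v : V} (hv : v ∈ s.red) :
    Invariant G L D (insert v E) ⟨s.red, insert v s.blue⟩ where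
  derivable := h.derivable
  red := h.red
  blue U hU u hu hb x hx := by
    rcases hb with rfl | hb
    · exact (h.red U hU _ hu hv x hx).imp_right fun hd => ⟨Set.mem_insert _ _, hd⟩
    · exact (h.blue U hU u hu hb x hx).imp_right fun hd => ⟨Set.mem_insert_of_mem _ hd.1, hd.2⟩

/-- The last edge of a walk into `v` comes from a red vertex, whose own walk is already accounted
for and is prolonged by one edge. Whether `v` was computed before plays no role. -/
theorem compute (h : Invariant G L D E s) {v : V} (hin : v ∉ inputs G)
    (hv : ∀ u, G.Adj u v → u ∈ s.red) : Invariant G L D E ⟨insert v s.red, s.blue⟩ where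
  derivable u hu := by
    rcases hu with rfl | hu
    · exact .step hin fun u hu => h.derivable u (hv u hu)
    · exact h.derivable u hu
  red U hU u hu hr x hx := by
    rcases hr with rfl | hr
    · have hd : Derivable G D u := .step hin fun y hy => h.derivable y (hv y hy)
      rcases Relation.ReflTransGen.cases_tail hx with rfl | ⟨y, hxy, hyu, hyU, -⟩
      · exact .inr ⟨hd, .refl⟩
      · exact (h.red U hU y hyU (hv y hyu) x hxy).imp_right fun hw =>
          ⟨hw.1, hw.2.tail ⟨hyu, hu, hd⟩⟩
    · exact h.red U hU u hu hr x hx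
  blue := h.blue

theorem free (h : Invariant G L D E s) {t : Config V} (hr : t.red ⊆ s.red)
    (hb : t.blue ⊆ s.blue) : Invariant G L D E t where
  derivable u hu := h.derivable u (hr hu)
  red U hU u hu hur := h.red U hU u hu (hr hur)
  blue U hU u hu hub := h.blue U hU u hu (hb hub)

end Invariant

/-- An invariant together with the number of I/O operations: `S` in each phase that is over,
and `d` in the current one. -/
structure Phases {V : Type} (G : Digraph V) (S : ℕ) (s : Config V) (q : ℕ)
    (L : List (Set V × Set V)) (D E : Set V) (d : ℕ) : Prop where
  inv : Invariant G L D E s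
  count : q = L.length * S + d
  le : d ≤ S
  list : ∀ P ∈ L, P.1.encard ≤ (S + S : ℕ) ∧ P.2.encard ≤ (S + S : ℕ)
  -- The first phase inherits no red pebbles; this gives the right size when no phase has been
  -- closed.
  card_D : D.encard ≤ ((if L = [] then 0 else S) + d : ℕ)
  card_E : E.encard ≤ (d : ℕ)

theorem Phases.close {V : Type} {G : Digraph V} {S q d : ℕ} {s : Config V}
    {L : List (Set V × Set V)} {D E : Set V} (h : Phases G S s q L D E d) (hd : d = S)
    (hs : s.red.encard ≤ S) : Phases G S s q ((D, E ∪ s.red) :: L) s.red ∅ 0 where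
  inv := h.inv.close
  count := by rw [h.count, hd, List.length_cons]; ring
  le := Nat.zero_le _
  list P hP := by
    rcases List.mem_cons.1 hP with rfl | hP
    · refine ⟨h.card_D.trans ?_, (Set.encard_union_le _ _).trans ?_⟩
      · rw [Nat.cast_le]
        split_ifs <;> omega
      · rw [Nat.cast_add]
        exact add_le_add (hd ▸ h.card_E) hs
    · exact h.list P hP
  card_D := by simpa using hs
  card_E := by simp

/-- Before an I/O operation the current phase may be assumed not to be full. -/
theorem Phases.exists_lt {V : Type} {G : Digraph V} {S q d : ℕ} (hS : 0 < S) {s : Config V}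
    {L : List (Set V × Set V)} {D E : Set V} (h : Phases G S s q L D E d)
    (hs : s.red.encard ≤ S) :
    ∃ L D E d, Phases G S s q L D E d ∧ d < S := by
  rcases h.le.lt_or_eq with hd | hd
  · exact ⟨L, D, E, d, h, hd⟩
  · exact ⟨_, _, _, _, h.close hd hs, hS⟩

theorem encard_insert_le_succ {V : Type} {A : Set V} {n : ℕ} (h : A.encard ≤ n) (v : V) :
    (insert v A).encard ≤ (n + 1 : ℕ) := by
  refine (Set.encard_insert_le A v).trans ?_
  push_cast
  gcongr

theorem Reach.exists_phases {V : Type} {G : Digraph V} {S : ℕ} (hS : 0 < S) {s : Config V} {q : ℕ}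
    (h : Reach G S s q) : ∃ L D E d, Phases G S s q L D E d := by
  induction h with
  | start =>
    -- The initial blue pebbles lie on inputs, which `U` avoids.
    exact ⟨[], ∅, ∅, 0, ⟨⟨by simp, by simp, fun U hU u hu hb => absurd hb (hU u hu)⟩,
      by simp, by simp, by simp, by simp, by simp⟩⟩
  | @move s t q d' hs hm ih =>
    obtain ⟨L, D, E, d, hP⟩ := ih
    cases hm with
    | load v hv hS' =>
      obtain ⟨L, D, E, d, hP, hd⟩ := hP.exists_lt hS hs.red_encard_le
      exact ⟨L, insert v D, E, d + 1, hP.inv.load hv, by rw [hP.count, add_assoc], hd, hP.list,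
        by simpa [add_assoc] using encard_insert_le_succ hP.card_D v,
        hP.card_E.trans (by simp)⟩
    | store v hv =>
      obtain ⟨L, D, E, d, hP, hd⟩ := hP.exists_lt hS hs.red_encard_le
      exact ⟨L, D, insert v E, d + 1, hP.inv.store hv, by rw [hP.count, add_assoc], hd, hP.list,
        hP.card_D.trans (by rw [Nat.cast_le]; omega), encard_insert_le_succ hP.card_E v⟩
    | compute v hin hv hS' =>
      exact ⟨L, D, E, d, hP.inv.compute hin hv, hP.count, hP.le, hP.list, hP.card_D, hP.card_E⟩
    | freeRed v =>
      exact ⟨L, D, E, d, hP.inv.free Set.sdiff_subset subset_rfl, hP.count, hP.le, hP.list,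
        hP.card_D, hP.card_E⟩
    | freeBlue v =>
      exact ⟨L, D, E, d, hP.inv.free subset_rfl Set.sdiff_subset, hP.count, hP.le, hP.list,
        hP.card_D, hP.card_E⟩

/-- A complete calculation with `Q` I/O operations splits into at most `2 Q / X` phases, each with
a set of at most `2 X` vertices from which everything in it is computed and a set of at most `2 X`
vertices that outlive it, such that every walk to an output starts in one of the phases. -/
theorem CompleteCalculation.exists_phases {V : Type} {G : Digraph V} {S Q : ℕ} (hS : 0 < S)
    (h : CompleteCalculation G S Q) :
    ∃ (X h : ℕ) (D E : Fin h → Finset V), X ≤ S ∧ h * X ≤ 2 * Q ∧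
      (∀ m, (D m).card ≤ 2 * X ∧ (E m).card ≤ 2 * X) ∧
      ∀ U : Set V, (∀ u ∈ U, u ∉ inputs G) → ∀ o ∈ U, o ∈ outputs G → ∀ v, Walk G U v o →
        ∃ m, Covered G U (D m, E m) v := by
  obtain ⟨s, hr, ho⟩ := h
  obtain ⟨L, D, E, d, hP⟩ := hr.exists_phases hS
  have key : ∃ X ≤ S, (L.length + 1) * X ≤ 2 * Q ∧
      ∀ P ∈ (D, E) :: L, P.1.encard ≤ (2 * X : ℕ) ∧ P.2.encard ≤ (2 * X : ℕ) := by
    have hc := hP.count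
    have hle := hP.le
    rcases eq_or_ne L [] with rfl | hL
    -- With no closed phase, `X = Q` works even when `Q` is smaller than `S`.
    · refine ⟨Q, by simp at hc; omega, by simp; omega, ?_⟩
      simp only [List.mem_singleton, forall_eq]
      simp only [List.length_nil, zero_mul, zero_add] at hc
      refine ⟨hP.card_D.trans ?_, hP.card_E.trans ?_⟩
      · rw [Nat.cast_le]; simp; omega
      · rw [Nat.cast_le]; omega
    · have h1 : 1 ≤ L.length := List.length_pos_iff.2 hL
      -- The unfinished phase at most doubles the number of phases.
      refine ⟨S, le_rfl, by nlinarith, fun P hPm => ?_⟩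
      rcases List.mem_cons.1 hPm with rfl | hPm
      · refine ⟨hP.card_D.trans ?_, hP.card_E.trans ?_⟩
        · rw [Nat.cast_le]; simp [hL]; omega
        · rw [Nat.cast_le]; omega
      · rw [two_mul]; exact hP.list P hPm
  obtain ⟨X, hXS, hX, hcard⟩ := key
  have hmem : ∀ m : Fin (L.length + 1), ((D, E) :: L)[m] ∈ (D, E) :: L :=
    fun m => List.getElem_mem _
  have hfD : ∀ m : Fin (L.length + 1), (((D, E) :: L)[m]).1.Finite := fun m =>
    Set.finite_of_encard_le_coe (hcard _ (hmem m)).1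
  have hfE : ∀ m : Fin (L.length + 1), (((D, E) :: L)[m]).2.Finite := fun m =>
    Set.finite_of_encard_le_coe (hcard _ (hmem m)).2
  refine ⟨X, L.length + 1, fun m => (hfD m).toFinset, fun m => (hfE m).toFinset, hXS, hX,
    fun m => ⟨?_, ?_⟩, fun U hU o hoU hoo v hv => ?_⟩
  · have := (hcard _ (hmem m)).1
    rwa [(hfD m).encard_eq_coe_toFinset_card, Nat.cast_le] at this
  · have := (hcard _ (hmem m)).2
    rwa [(hfE m).encard_eq_coe_toFinset_card, Nat.cast_le] at this
  · have : ∃ P ∈ (D, E) :: L, Covered G U P v := by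
      rcases hP.inv.blue U hU o hoU (ho hoo) v hv with ⟨P, hPm, hc⟩ | ⟨hE, hd⟩
      · exact ⟨P, List.mem_cons_of_mem _ hPm, hc⟩
      · exact ⟨_, List.mem_cons_self, o, hoU, hE, hd⟩
    obtain ⟨P, hPm, hc⟩ := this
    obtain ⟨m, hm, rfl⟩ := List.getElem_of_mem hPm
    refine ⟨⟨m, by simpa using hm⟩, ?_⟩
    simpa using hc

end PebbleGame

/-! ### Counting by relations and projections -/

/-- If every element of `A` is related to an element of `D`, and no element of `D` is related to
two elements of `A`, then `A` has at most as many elements as `D`. -/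
theorem Finset.card_le_of_relation {α β : Type} (A : Finset α) (D : Finset β) (R : α → β → Prop)
    (h : ∀ a ∈ A, ∃ d ∈ D, R a d) (hR : ∀ a a' d, R a d → R a' d → a = a') :
    A.card ≤ D.card := by
  rcases A.eq_empty_or_nonempty with rfl | ⟨a₀, ha₀⟩
  · simp
  obtain ⟨d₀, -⟩ := h a₀ ha₀
  have : Nonempty β := ⟨d₀⟩
  choose! f hf using h
  exact Finset.card_le_card_of_injOn f (fun a ha => (hf a ha).1) fun a ha a' ha' haa =>
    hR a a' (f a) (hf a ha).2 (haa ▸ (hf a' ha').2)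

/-- The discrete Loomis–Whitney inequality in dimension three. -/
theorem Finset.card_sq_le_of_projections {α β γ : Type} [DecidableEq α] [DecidableEq β]
    [DecidableEq γ] (W : Finset (α × β × γ)) (K : Finset (α × β)) (A : Finset (α × γ))
    (B : Finset (β × γ)) (hK : ∀ w ∈ W, (w.1, w.2.1) ∈ K) (hA : ∀ w ∈ W, (w.1, w.2.2) ∈ A)
    (hB : ∀ w ∈ W, w.2 ∈ B) : W.card ^ 2 ≤ K.card * (A.card * B.card) := by
  have hsum : W.card = ∑ x ∈ K, (W.filter fun w => (w.1, w.2.1) = x).card :=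
    Finset.card_eq_sum_card_fiberwise hK
  rw [hsum]
  -- Cauchy–Schwarz over the fibres above `K`; the squares count pairs of points in a common fibre.
  refine sq_sum_le_card_mul_sum_sq.trans (Nat.mul_le_mul_left _ ?_)
  rw [← Finset.card_product]
  have : ∀ x ∈ K, (W.filter fun w => (w.1, w.2.1) = x).card ^ 2
      = ((W.filter fun w => (w.1, w.2.1) = x) ×ˢ (W.filter fun w => (w.1, w.2.1) = x)).card :=
    fun x _ => by rw [Finset.card_product, sq]
  rw [Finset.sum_congr rfl this, ← Finset.card_sigma]
  -- A pair `(a, b, c)`, `(a, b, c')` is recovered from `(a, c)` and `(b, c')`.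
  refine Finset.card_le_card_of_injOn (fun y => ((y.2.1.1, y.2.1.2.2), y.2.2.2)) ?_ ?_
  · rintro ⟨x, u, v⟩ hy
    simp only [Finset.coe_sigma, Set.mem_sigma_iff, Finset.mem_coe, Finset.mem_product,
      Finset.mem_filter] at hy
    simp only [Finset.mem_coe, Finset.mem_product]
    exact ⟨hA u hy.2.1.1, hB v hy.2.2.1⟩
  · rintro ⟨x, ⟨a, b, c⟩, ⟨a', b', c'⟩⟩ hy ⟨x', ⟨a₁, b₁, c₁⟩, ⟨a₁', b₁', c₁'⟩⟩ hy' heq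
    simp only [Finset.coe_sigma, Set.mem_sigma_iff, Finset.mem_coe, Finset.mem_product,
      Finset.mem_filter] at hy hy'
    obtain ⟨-, ⟨-, rfl⟩, -, h2⟩ := hy
    obtain ⟨-, ⟨-, rfl⟩, -, h4⟩ := hy'
    simp only [Prod.mk.injEq] at heq h2 h4
    obtain ⟨⟨rfl, rfl⟩, rfl, rfl⟩ := heq
    obtain ⟨rfl, rfl⟩ := h2
    obtain ⟨rfl, rfl⟩ := h4
    rfl

/-! ### Summation trees and their copies in a graph -/

namespace BinTree

variable {α : Type}

theorem self_mem_subtrees (t : BinTree α) : t ∈ t.subtrees := by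
  cases t <;> simp [subtrees]

theorem subtrees_subset {s t : BinTree α} (h : s ∈ t.subtrees) : s.subtrees ⊆ t.subtrees := by
  induction t with
  | leaf a =>
    simp only [subtrees, Set.mem_singleton_iff] at h
    rw [h]
  | node l r ihl ihr =>
    simp only [subtrees, Set.mem_insert_iff, Set.mem_union] at h
    rcases h with rfl | h | h
    · exact subset_rfl
    · exact (ihl h).trans fun x hx => .inr (.inl hx)
    · exact (ihr h).trans fun x hx => .inr (.inr hx)

theorem IsChild.mem_subtrees {s t : BinTree α} (h : s.IsChild t) : s ∈ t.subtrees := by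
  obtain ⟨u, rfl | rfl⟩ := h
  · exact .inr (.inl s.self_mem_subtrees)
  · exact .inr (.inr s.self_mem_subtrees)

theorem leaf_mem_subtrees {t : BinTree α} {a : α} (h : a ∈ t.leaves) : leaf a ∈ t.subtrees := by
  induction t with
  | leaf b =>
    simp only [leaves, List.mem_singleton] at h
    rw [h]
    exact self_mem_subtrees _
  | node l r ihl ihr =>
    rcases List.mem_append.1 h with h | h
    · exact .inr (.inl (ihl h))
    · exact .inr (.inr (ihr h))

theorem sizeOf_le_of_mem_subtrees {s t : BinTree α} (h : s ∈ t.subtrees) :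
    sizeOf s ≤ sizeOf t := by
  induction t with
  | leaf a =>
    simp only [subtrees, Set.mem_singleton_iff] at h
    rw [h]
  | node l r ihl ihr =>
    simp only [subtrees, Set.mem_insert_iff, Set.mem_union] at h
    rcases h with rfl | h | h
    · exact le_rfl
    · exact (ihl h).trans (by simp +arith)
    · exact (ihr h).trans (by simp +arith)

theorem not_isChild_of_mem_subtrees {s t : BinTree α} (h : s ∈ t.subtrees) : ¬ t.IsChild s := by
  have h := sizeOf_le_of_mem_subtrees h
  rintro ⟨u, rfl | rfl⟩ <;> simp +arith at h

end BinTree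

namespace SumTree

variable {α : Type}

/-- The root of a summation tree. -/
def root (t : SumTree α) : t.Vertex := ⟨t.tree, t.tree.self_mem_subtrees⟩

/-- The leaf of a summation tree with a given label. -/
def leaf (t : SumTree α) (a : α) : t.Vertex :=
  ⟨.leaf a, BinTree.leaf_mem_subtrees (t.mem_leaves a)⟩

end SumTree

namespace PebbleGame

/-- In a copy of a tree inside a graph, every vertex has a walk to the root. -/
theorem walk_root {V α : Type} {G : Digraph V} (t : SumTree α) (φ : t.Vertex → V)
    (hφ : ∀ s s' : t.Vertex, s.1.IsChild s'.1 → G.Adj (φ s) (φ s')) {U : Set V}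
    (hU : ∀ s, φ s ∈ U) (s : t.Vertex) : Walk G U (φ s) (φ t.root) := by
  suffices H : ∀ (b : BinTree α) (hb : b ∈ t.tree.subtrees) (s : t.Vertex), s.1 ∈ b.subtrees →
      Walk G U (φ s) (φ ⟨b, hb⟩) from H _ _ s s.2
  intro b
  induction b with
  | leaf a =>
    rintro hb ⟨s, hs⟩ h
    obtain rfl : s = .leaf a := h
    exact .refl
  | node l r ihl ihr =>
    rintro hb ⟨s, hs⟩ h
    have hcl : l.IsChild (.node l r) := ⟨r, .inl rfl⟩
    have hcr : r.IsChild (.node l r) := ⟨l, .inr rfl⟩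
    have hl := BinTree.subtrees_subset hb hcl.mem_subtrees
    have hr := BinTree.subtrees_subset hb hcr.mem_subtrees
    rcases h with h | h | h
    · obtain rfl : s = _ := h
      exact .refl
    · exact (ihl hl ⟨s, hs⟩ h).tail ⟨hφ ⟨l, hl⟩ ⟨_, hb⟩ hcl, hU _, hU _⟩
    · exact (ihr hr ⟨s, hs⟩ h).tail ⟨hφ ⟨r, hr⟩ ⟨_, hb⟩ hcr, hU _, hU _⟩

/-- If the root of a copy of a tree is computed without starting from a vertex of the tree, then
all leaves are computed. -/
theorem Derivable.leaf_of_root {V α : Type} {G : Digraph V} {D : Set V} (t : SumTree α)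
    (φ : t.Vertex → V) (hφ : ∀ s s' : t.Vertex, s.1.IsChild s'.1 → G.Adj (φ s) (φ s'))
    (hD : ∀ s, φ s ∉ D) (h : Derivable G D (φ t.root)) (a : α) : Derivable G D (φ (t.leaf a)) := by
  suffices H : ∀ (b : BinTree α) (hb : b ∈ t.tree.subtrees), Derivable G D (φ ⟨b, hb⟩) →
      ∀ (a : α), a ∈ b.leaves → Derivable G D (φ (t.leaf a)) from
    H _ _ h a (t.mem_leaves a)
  intro b
  induction b with
  | leaf a' =>
    intro hb h a ha
    obtain rfl : a = a' := by simpa [BinTree.leaves] using ha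
    exact h
  | node l r ihl ihr =>
    intro hb h a ha
    have hcl : l.IsChild (.node l r) := ⟨r, .inl rfl⟩
    have hcr : r.IsChild (.node l r) := ⟨l, .inr rfl⟩
    have hl := BinTree.subtrees_subset hb hcl.mem_subtrees
    have hr := BinTree.subtrees_subset hb hcr.mem_subtrees
    rcases List.mem_append.1 ha with ha | ha
    · exact ihl hl (h.of_adj (hD _) (hφ ⟨l, hl⟩ ⟨_, hb⟩ hcl)) a ha
    · exact ihr hr (h.of_adj (hD _) (hφ ⟨r, hr⟩ ⟨_, hb⟩ hcr)) a ha

/-- In a copy of a tree inside a graph whose leaves have predecessors, no vertex is an input. -/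
theorem notMem_inputs {V α : Type} {G : Digraph V} (t : SumTree α) (φ : t.Vertex → V)
    (hφ : ∀ s s' : t.Vertex, s.1.IsChild s'.1 → G.Adj (φ s) (φ s'))
    (hleaf : ∀ a, ∃ u, G.Adj u (φ (t.leaf a))) (s : t.Vertex) : φ s ∉ inputs G := by
  intro h
  obtain ⟨s, hs⟩ := s
  cases s with
  | leaf a =>
    obtain ⟨u, hu⟩ := hleaf a
    exact h u hu
  | node l r =>
    have hcl : l.IsChild (.node l r) := ⟨r, .inl rfl⟩
    exact h _ (hφ ⟨l, BinTree.subtrees_subset hs hcl.mem_subtrees⟩ ⟨_, hs⟩ hcl)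

end PebbleGame

/-! ### What a phase needs in the Winograd graph -/

namespace Winograd

open PebbleGame

section Graph

variable {w : Params} {κ ν : Type} {f : Fin w.Cout → κ} {g : w.Tile → ν} {T : Trees w κ ν}

theorem mul_add_lt {e r W : ℕ} (i : Fin (W / e)) (a : Fin (e + r - 1)) :
    e * i.1 + a.1 < W + r - 1 := by
  have h1 : e * (i.1 + 1) ≤ W :=
    (Nat.mul_le_mul_left e i.2).trans (Nat.mul_div_le W e)
  have h2 := a.2
  rw [mul_add] at h1
  omega

/-- The entry at position `a` of the input window of tile `i` in channel `c`. -/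
def windowVertex (T : Trees w κ ν) (i : w.Tile) (c : Fin w.Cin) (a : w.Pos) : Vertex w T :=
  .img ⟨w.e * i.1.1 + a.1.1, mul_add_lt i.1 a.1⟩ ⟨w.e * i.2.1 + a.2.1, mul_add_lt i.2 a.2⟩ c

theorem img_mem_inputs (x : Fin (w.Wout + w.r - 1)) (y : Fin (w.Hout + w.r - 1)) (c : Fin w.Cin) :
    (.img x y c : Vertex w T) ∈ inputs (graph w f g T) := by
  intro u h
  cases u <;> exact h

theorem ker_mem_inputs (k : Fin w.Cout) (c : Fin w.Cin) (a : Fin w.r × Fin w.r) :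
    (.ker k c a : Vertex w T) ∈ inputs (graph w f g T) := by
  intro u h
  cases u <;> exact h

theorem adj_window_leaf (i : w.Tile) (j : κ) (c : Fin w.Cin) (p a : w.Pos) :
    (graph w f g T).Adj (windowVertex T i c a) (.inT i j c p ((T.inT i j c p).leaf a)) :=
  ⟨rfl, a, rfl, rfl, rfl⟩

theorem adj_ker_leaf (k : Fin w.Cout) (j : ν) (c : Fin w.Cin) (p : w.Pos)
    (a : Fin w.r × Fin w.r) :
    (graph w f g T).Adj (.ker k c a) (.kerT k j c p ((T.kerT k j c p).leaf a)) :=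
  ⟨rfl, rfl, rfl⟩

theorem adj_inT_sumT (i : w.Tile) (k : Fin w.Cout) (c : Fin w.Cin) (p : w.Pos) :
    (graph w f g T).Adj (.inT i (f k) c p (T.inT i (f k) c p).root)
      (.sumT i k p ((T.sumT i k p).leaf c)) :=
  ⟨rfl, rfl, rfl, rfl, rfl⟩

theorem adj_kerT_sumT (i : w.Tile) (k : Fin w.Cout) (c : Fin w.Cin) (p : w.Pos) :
    (graph w f g T).Adj (.kerT k (g i) c p (T.kerT k (g i) c p).root)
      (.sumT i k p ((T.sumT i k p).leaf c)) :=
  ⟨rfl, rfl, rfl, rfl, rfl⟩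

theorem adj_sumT_outT (i : w.Tile) (k : Fin w.Cout) (p : w.Pos) (q : Fin w.e × Fin w.e) :
    (graph w f g T).Adj (.sumT i k p (T.sumT i k p).root)
      (.outT i k q ((T.outT i k q).leaf p)) :=
  ⟨rfl, rfl, rfl, rfl⟩

theorem adj_inT (i : w.Tile) (j : κ) (c : Fin w.Cin) (p : w.Pos) (s s' : (T.inT i j c p).Vertex)
    (h : s.1.IsChild s'.1) : (graph w f g T).Adj (.inT i j c p s) (.inT i j c p s') :=
  ⟨rfl, rfl, rfl, rfl, h⟩

theorem adj_kerT (k : Fin w.Cout) (j : ν) (c : Fin w.Cin) (p : w.Pos)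
    (s s' : (T.kerT k j c p).Vertex) (h : s.1.IsChild s'.1) :
    (graph w f g T).Adj (.kerT k j c p s) (.kerT k j c p s') :=
  ⟨rfl, rfl, rfl, rfl, h⟩

theorem adj_sumT (i : w.Tile) (k : Fin w.Cout) (p : w.Pos) (s s' : (T.sumT i k p).Vertex)
    (h : s.1.IsChild s'.1) : (graph w f g T).Adj (.sumT i k p s) (.sumT i k p s') :=
  ⟨rfl, rfl, rfl, h⟩

theorem adj_outT (i : w.Tile) (k : Fin w.Cout) (q : Fin w.e × Fin w.e)
    (s s' : (T.outT i k q).Vertex) (h : s.1.IsChild s'.1) :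
    (graph w f g T).Adj (.outT i k q s) (.outT i k q s') :=
  ⟨rfl, rfl, rfl, h⟩

theorem outT_root_mem_outputs (i : w.Tile) (k : Fin w.Cout) (q : Fin w.e × Fin w.e) :
    (.outT i k q (T.outT i k q).root : Vertex w T) ∈ outputs (graph w f g T) := by
  intro u h
  cases u with
  | outT i' k' q' s =>
    obtain ⟨rfl, rfl, rfl, h⟩ := h
    exact BinTree.not_isChild_of_mem_subtrees s.2 h
  | _ => exact h

theorem inT_notMem_inputs (i : w.Tile) (j : κ) (c : Fin w.Cin) (p : w.Pos)
    (s : (T.inT i j c p).Vertex) : (.inT i j c p s : Vertex w T) ∉ inputs (graph w f g T) :=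
  notMem_inputs _ (Vertex.inT i j c p) (adj_inT i j c p)
    (fun a => ⟨_, adj_window_leaf i j c p a⟩) s

theorem sumT_notMem_inputs (i : w.Tile) (k : Fin w.Cout) (p : w.Pos)
    (s : (T.sumT i k p).Vertex) : (.sumT i k p s : Vertex w T) ∉ inputs (graph w f g T) :=
  notMem_inputs _ (Vertex.sumT i k p) (adj_sumT i k p)
    (fun c => ⟨_, adj_inT_sumT i k c p⟩) s

theorem outT_notMem_inputs (i : w.Tile) (k : Fin w.Cout) (q : Fin w.e × Fin w.e)
    (s : (T.outT i k q).Vertex) : (.outT i k q s : Vertex w T) ∉ inputs (graph w f g T) :=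
  notMem_inputs _ (Vertex.outT i k q) (adj_outT i k q)
    (fun p => ⟨_, adj_sumT_outT i k p q⟩) s

/-- If `D` misses the tree, computing the root forces every leaf to be computed, and the leaves use
all window entries. These are inputs, so they can only come from `D`. -/
theorem window_mem_of_derivable {D : Set (Vertex w T)} {i : w.Tile} {j : κ} {c : Fin w.Cin}
    {p : w.Pos} (h : Derivable (graph w f g T) D (.inT i j c p (T.inT i j c p).root)) :
    (∃ s, .inT i j c p s ∈ D) ∨ ∀ a, windowVertex T i c a ∈ D := by
  refine or_iff_not_imp_left.2 fun hD a => ?_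
  have hD : ∀ s, (.inT i j c p s : Vertex w T) ∉ D := fun s hs => hD ⟨s, hs⟩
  exact ((h.leaf_of_root _ _ (adj_inT i j c p) hD a).of_adj (hD _)
    (adj_window_leaf i j c p a)).mem_of_mem_inputs (img_mem_inputs _ _ _)

theorem ker_mem_of_derivable {D : Set (Vertex w T)} {k : Fin w.Cout} {j : ν} {c : Fin w.Cin}
    {p : w.Pos} (h : Derivable (graph w f g T) D (.kerT k j c p (T.kerT k j c p).root)) :
    (∃ s, .kerT k j c p s ∈ D) ∨ ∀ a, .ker k c a ∈ D := by
  refine or_iff_not_imp_left.2 fun hD a => ?_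
  have hD : ∀ s, (.kerT k j c p s : Vertex w T) ∉ D := fun s hs => hD ⟨s, hs⟩
  exact ((h.leaf_of_root _ _ (adj_kerT k j c p) hD a).of_adj (hD _)
    (adj_ker_leaf k j c p a)).mem_of_mem_inputs (ker_mem_inputs _ _ _)

/-- The vertices of the sum over the channels at position `p` and of the linear combination that
forms output `q`, for tile `i` and kernel `k`. -/
def resultTrees (T : Trees w κ ν) (i : w.Tile) (k : Fin w.Cout) (p : w.Pos)
    (q : Fin w.e × Fin w.e) : Set (Vertex w T) :=
  {v | (∃ s, v = .sumT i k p s) ∨ ∃ s, v = .outT i k q s}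

theorem notMem_inputs_of_mem_resultTrees {i : w.Tile} {k : Fin w.Cout} {p : w.Pos}
    {q : Fin w.e × Fin w.e} {v : Vertex w T} (hv : v ∈ resultTrees T i k p q) :
    v ∉ inputs (graph w f g T) := by
  rcases hv with ⟨s, rfl⟩ | ⟨s, rfl⟩
  · exact sumT_notMem_inputs _ _ _ _
  · exact outT_notMem_inputs _ _ _ _

theorem walk_output {U : Set (Vertex w T)} {i : w.Tile} {k : Fin w.Cout} {p : w.Pos}
    {q : Fin w.e × Fin w.e} (hU : resultTrees T i k p q ⊆ U) (s : (T.sumT i k p).Vertex) :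
    Walk (graph w f g T) U (.sumT i k p s) (.outT i k q (T.outT i k q).root) := by
  have h1 : ∀ s, (.sumT i k p s : Vertex w T) ∈ U := fun s => hU (.inl ⟨s, rfl⟩)
  have h2 : ∀ s, (.outT i k q s : Vertex w T) ∈ U := fun s => hU (.inr ⟨s, rfl⟩)
  exact ((walk_root _ _ (adj_sumT i k p) h1 s).tail ⟨adj_sumT_outT i k p q, h1 _, h2 _⟩).trans
    (walk_root _ _ (adj_outT i k q) h2 _)

/-- What a phase must have available when it performs the product at position `p` in channel `c`
for tile `i` and kernel `k`. -/
theorem product_of_covered {P : Set (Vertex w T) × Set (Vertex w T)} {i : w.Tile} {k : Fin w.Cout}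
    {p : w.Pos} {q : Fin w.e × Fin w.e} {c : Fin w.Cin}
    (h : Covered (graph w f g T) (resultTrees T i k p q) P
      (.sumT i k p ((T.sumT i k p).leaf c))) :
    (.sumT i k p ((T.sumT i k p).leaf c) ∈ P.1 ∨
      ((∃ s, .inT i (f k) c p s ∈ P.1) ∨ ∀ a, windowVertex T i c a ∈ P.1) ∧
      ((∃ s, .kerT k (g i) c p s ∈ P.1) ∨ ∀ a, .ker k c a ∈ P.1)) ∧
    ∃ v ∈ P.2, v ∈ resultTrees T i k p q := by
  obtain ⟨v, hvU, hvE, hd, -⟩ := h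
  refine ⟨or_iff_not_imp_left.2 fun hD => ⟨?_, ?_⟩, v, hvE, hvU⟩
  · exact window_mem_of_derivable (hd.of_adj hD (adj_inT_sumT i k c p))
  · exact ker_mem_of_derivable (hd.of_adj hD (adj_kerT_sumT i k c p))

/-- What a phase must have available, or leave behind, when it multiplies entry `a` of a window by
its coefficient in the linear combination for position `p`. -/
theorem window_product_of_covered {P : Set (Vertex w T) × Set (Vertex w T)} {i : w.Tile}
    {k : Fin w.Cout} {p a : w.Pos} {q : Fin w.e × Fin w.e} {c : Fin w.Cin}
    (h : Covered (graph w f g T)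
      ({v | ∃ s, v = .inT i (f k) c p s} ∪ resultTrees T i k p q) P
      (.inT i (f k) c p ((T.inT i (f k) c p).leaf a))) :
    (.inT i (f k) c p ((T.inT i (f k) c p).leaf a) ∈ P.1 ∨ windowVertex T i c a ∈ P.1) ∧
    ((∃ s, .inT i (f k) c p s ∈ P.1) ∨ (∃ s, .inT i (f k) c p s ∈ P.2) ∨
      ∀ a, windowVertex T i c a ∈ P.1) := by
  obtain ⟨v, hvU, hvE, hd, hw⟩ := h
  refine ⟨or_iff_not_imp_left.2 fun hD => (hd.of_adj hD
    (adj_window_leaf i (f k) c p a)).mem_of_mem_inputs (img_mem_inputs _ _ _), ?_⟩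
  -- The walk can leave the transform only along the edge from its root to a product, so either it
  -- stays inside or the root is derivable.
  have key : (∃ s, v = .inT i (f k) c p s ∧ Derivable (graph w f g T) P.1 v) ∨
      Derivable (graph w f g T) P.1 (.inT i (f k) c p (T.inT i (f k) c p).root) := by
    clear hvE hvU
    induction hw with
    | refl => exact .inl ⟨_, rfl, hd⟩
    | tail _ hab ih =>
      obtain ⟨hadj, hU, hder⟩ := hab
      rcases ih with ⟨s, rfl, hs⟩ | ih
      · rcases hU with ⟨s', rfl⟩ | ⟨s', rfl⟩ | ⟨s', rfl⟩
        · exact .inl ⟨s', rfl, hder⟩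
        · obtain ⟨-, -, -, hroot, -⟩ := hadj
          have : s = (T.inT i (f k) c p).root := Subtype.ext hroot
          exact .inr (this ▸ hs)
        · exact hadj.elim
      · exact .inr ih
  rcases key with ⟨s, rfl, -⟩ | hroot
  · exact .inr (.inl ⟨s, hvE⟩)
  · exact (window_mem_of_derivable hroot).imp_right .inr

end Graph

end Winograd

/-! ### Summing over the phases -/

theorem Fintype.card_mul_le_of_cover {ι : Type} [Fintype ι] {h : ℕ} {ρ F : ℝ} (hρ : 0 ≤ ρ)
    (W : Fin h → Set ι) (hcov : ∀ x, ∃ m, x ∈ W m)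
    (hW : ∀ m (A : Finset ι), (∀ x ∈ A, x ∈ W m) → A.card * ρ ≤ F) :
    Fintype.card ι * ρ ≤ h * F := by
  classical
  have hsub : (Finset.univ : Finset ι) ⊆
      Finset.univ.biUnion fun m => Finset.univ.filter (· ∈ W m) := by
    intro x _
    obtain ⟨m, hm⟩ := hcov x
    simp only [Finset.mem_biUnion, Finset.mem_filter, Finset.mem_univ, true_and]
    exact ⟨m, hm⟩
  have h1 : Fintype.card ι ≤ ∑ m, (Finset.univ.filter (· ∈ W m)).card :=
    (Finset.card_le_card hsub).trans Finset.card_biUnion_le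
  calc (Fintype.card ι : ℝ) * ρ ≤ ((∑ m, (Finset.univ.filter (· ∈ W m)).card : ℕ) : ℝ) * ρ := by
        gcongr
    _ = ∑ m, ((Finset.univ.filter (· ∈ W m)).card : ℝ) * ρ := by
        rw [Nat.cast_sum, Finset.sum_mul]
    _ ≤ ∑ _m : Fin h, F := Finset.sum_le_sum fun m _ => hW m _ fun x hx => by simpa using hx
    _ = h * F := by simp

/-- A bound on `b + g` from `b ≤ N` and `(g r)² ≤ N³` when `r² ≤ N`. -/
theorem add_mul_le_of_sq_le {b g N r : ℕ} (hb : b ≤ N) (hr : r ^ 2 ≤ N)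
    (hg : (g * r) ^ 2 ≤ N ^ 3) : ((b + g : ℕ) : ℝ) * r ≤ 2 * (N * √N) := by
  have hN : (N * √N : ℝ) ^ 2 = N ^ 3 := by
    rw [mul_pow, Real.sq_sqrt (Nat.cast_nonneg _)]
    ring
  have hg' : (g * r : ℝ) ≤ N * √N := by
    refine le_of_sq_le_sq ?_ (by positivity)
    rw [hN]
    exact_mod_cast hg
  have hr' : (r : ℝ) ≤ √N := Real.le_sqrt_of_sq_le (by exact_mod_cast hr)
  have hb' : (b * r : ℝ) ≤ N * √N := by
    have : (b : ℝ) ≤ N := by exact_mod_cast hb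
    gcongr
  push_cast
  linarith

/-- The total over all phases. -/
theorem mul_mul_sqrt_le {X h S Q : ℕ} (hX : X ≤ S) (hQ : h * X ≤ 2 * Q) :
    (h : ℝ) * (2 * ((2 * X : ℕ) * √(2 * X : ℕ))) ≤ 12 * (Q * √S) := by
  -- The constant comes from `2 ≤ (3 / 2) ^ 2`.
  have h1 : √((2 * X : ℕ) : ℝ) ≤ 3 / 2 * √S := by
    rw [show (3 / 2 : ℝ) * √S = √((3 / 2) ^ 2 * S) by
      rw [Real.sqrt_mul (by positivity), Real.sqrt_sq (by positivity)]]
    apply Real.sqrt_le_sqrt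
    have : (X : ℝ) ≤ S := by exact_mod_cast hX
    push_cast
    linarith [(Nat.cast_nonneg S : (0 : ℝ) ≤ S)]
  have h2 : (h * X : ℝ) ≤ 2 * Q := by exact_mod_cast hQ
  calc (h : ℝ) * (2 * ((2 * X : ℕ) * √(2 * X : ℕ))) = 4 * (h * X) * √(2 * X : ℕ) := by
        push_cast; ring
    _ ≤ 4 * (2 * Q) * (3 / 2 * √S) := by gcongr
    _ = 12 * (Q * √S) := by ring

/-! ### How much one phase can cover -/

namespace Winograd

open PebbleGame

/-- A common vertex lies in a channel sum, which fixes `p`, or in an output tree, which fixes `q`.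
Tying `p` injectively to `q` makes both cases equally informative. -/
theorem resultTrees_disjoint {w : Params} {κ ν : Type} {T : Trees w κ ν} {i i' : w.Tile}
    {k k' : Fin w.Cout} {p p' : w.Pos} {q q' : Fin w.e × Fin w.e} {v : Vertex w T}
    (h : v ∈ resultTrees T i k p q) (h' : v ∈ resultTrees T i' k' p' q') :
    i = i' ∧ k = k' ∧ (p = p' ∨ q = q') := by
  rcases h with ⟨s, rfl⟩ | ⟨s, rfl⟩ <;> rcases h' with ⟨s', h'⟩ | ⟨s', h'⟩
  · injection h' with h1 h2 h3
    exact ⟨h1, h2, .inl h3⟩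
  · cases h'
  · cases h'
  · injection h' with h1 h2 h3
    exact ⟨h1, h2, .inr h3⟩

/-- The number of products at one position in one phase, when transforms may be shared. -/
theorem card_products_le {w : Params} {κ ν : Type} {f : Fin w.Cout → κ} {g : w.Tile → ν}
    {T : Trees w κ ν} (hr : 0 < w.r) (p : w.Pos) (q : Fin w.e × Fin w.e) {N : ℕ}
    {D E : Finset (Vertex w T)} (hD : D.card ≤ N) (hE : E.card ≤ N)
    (W : Finset (w.Tile × Fin w.Cout × Fin w.Cin))
    (hW : ∀ x ∈ W, Covered (graph w f g T) (resultTrees T x.1 x.2.1 p q) (D, E)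
      (.sumT x.1 x.2.1 p ((T.sumT x.1 x.2.1 p).leaf x.2.2))) :
    ∃ b c, W.card = b + c ∧ b ≤ N ∧ c ^ 2 ≤ N ^ 3 := by
  classical
  let bad : w.Tile × Fin w.Cout × Fin w.Cin → Prop := fun x =>
    .sumT x.1 x.2.1 p ((T.sumT x.1 x.2.1 p).leaf x.2.2) ∈ D
  let W' := W.filter fun x => ¬ bad x
  have hgood := fun x (hx : x ∈ W') =>
    ((product_of_covered (hW x (Finset.mem_filter.1 hx).1)).1.resolve_left
      (Finset.mem_filter.1 hx).2)
  have hout := fun x (hx : x ∈ W') => (product_of_covered (hW x (Finset.mem_filter.1 hx).1)).2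
  refine ⟨(W.filter bad).card, W'.card, (Finset.card_filter_add_card_filter_not _).symm,
    le_trans ?_ hD, ?_⟩
  · refine Finset.card_le_of_relation _ _ (fun x d => d = .sumT x.1 x.2.1 p
      ((T.sumT x.1 x.2.1 p).leaf x.2.2)) (fun x hx => ⟨_, (Finset.mem_filter.1 hx).2, rfl⟩) ?_
    rintro ⟨i, k, c⟩ ⟨i', k', c'⟩ d rfl h
    injection h with h1 h2 h3 h4
    dsimp only at h1 h2
    subst h1 h2
    have h5 := congrArg Subtype.val (eq_of_heq h4)
    injection h5 with h5
    dsimp only at h5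
    subst h5
    rfl
  · have hK : (W'.image fun x => (x.1, x.2.1)).card ≤ N := by
      refine le_trans (Finset.card_le_of_relation _ E
        (fun x v => v ∈ resultTrees T x.1 x.2 p q) ?_ ?_) hE
      · intro y hy
        obtain ⟨x, hx, rfl⟩ := Finset.mem_image.1 hy
        exact hout x hx
      · rintro ⟨i, k⟩ ⟨i', k'⟩ v h h'
        obtain ⟨rfl, rfl, -⟩ := resultTrees_disjoint h h'
        rfl
    -- With `p` fixed, the window entry at `p` determines the tile, although windows overlap.
    have hA : (W'.image fun x => (x.1, x.2.2)).card ≤ N := by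
      refine le_trans (Finset.card_le_of_relation _ D
        (fun x v => (∃ j s, v = .inT x.1 j x.2 p s) ∨ v = windowVertex T x.1 x.2 p) ?_ ?_) hD
      · intro y hy
        obtain ⟨x, hx, rfl⟩ := Finset.mem_image.1 hy
        rcases (hgood x hx).1 with ⟨s, hs⟩ | h
        · exact ⟨_, hs, .inl ⟨_, _, rfl⟩⟩
        · exact ⟨_, h p, .inr rfl⟩
      · rintro ⟨i, c⟩ ⟨i', c'⟩ v h h'
        rcases h with ⟨j, s, rfl⟩ | rfl <;> rcases h' with ⟨j', s', h'⟩ | h'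
        · injection h' with h1 h2 h3
          exact Prod.ext h1 h3
        · cases h'
        · cases h'
        · injection h' with h1 h2 h3
          have he : 0 < w.e := q.1.pos
          have h1 := congrArg Fin.val h1
          have h2 := congrArg Fin.val h2
          dsimp only at h1 h2 h3
          have h1 := Nat.eq_of_mul_eq_mul_left he (Nat.add_right_cancel h1)
          have h2 := Nat.eq_of_mul_eq_mul_left he (Nat.add_right_cancel h2)
          rw [Prod.ext (Fin.ext h1) (Fin.ext h2) (y := i'), h3]
    have hB : (W'.image fun x => x.2).card ≤ N := by
      refine le_trans (Finset.card_le_of_relation _ D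
        (fun x v => (∃ j s, v = .kerT x.1 j x.2 p s) ∨ v = .ker x.1 x.2 (⟨0, hr⟩, ⟨0, hr⟩))
        ?_ ?_) hD
      · intro y hy
        obtain ⟨x, hx, rfl⟩ := Finset.mem_image.1 hy
        rcases (hgood x hx).2 with ⟨s, hs⟩ | h
        · exact ⟨_, hs, .inl ⟨_, _, rfl⟩⟩
        · exact ⟨_, h _, .inr rfl⟩
      · rintro ⟨k, c⟩ ⟨k', c'⟩ v h h'
        rcases h with ⟨j, s, rfl⟩ | rfl <;> rcases h' with ⟨j', s', h'⟩ | h'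
        · injection h' with h1 h2 h3
          exact Prod.ext h1 h3
        · cases h'
        · cases h'
        · injection h' with h1 h2
          exact Prod.ext h1 h2
    refine (Finset.card_sq_le_of_projections W' _ _ _
      (fun x hx => Finset.mem_image_of_mem (fun x => (x.1, x.2.1)) hx)
      (fun x hx => Finset.mem_image_of_mem (fun x => (x.1, x.2.2)) hx)
      (fun x hx => Finset.mem_image_of_mem (fun x => x.2) hx)).trans ?_
    calc _ ≤ N * (N * N) := Nat.mul_le_mul hK (Nat.mul_le_mul hA hB)
      _ = N ^ 3 := by ring

/-- A position in an output tile, as a position in a window. -/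
def Params.core (w : Params) (hr : 0 < w.r) (q : Fin w.e × Fin w.e) : w.Pos :=
  (Fin.castLE (by simp only [Params.n]; omega) q.1, Fin.castLE (by simp only [Params.n]; omega) q.2)

theorem Params.core_injective (w : Params) (hr : 0 < w.r) : Function.Injective (w.core hr) := by
  rintro ⟨a, b⟩ ⟨a', b'⟩ h
  simpa [Params.core] using h

/-- Windows overlap, but their `e × e` corners do not: division by `e` with remainder recovers tile
and offset. -/
theorem windowVertex_core_injective {w : Params} {κ ν : Type} (T : Trees w κ ν) (hr : 0 < w.r)
    {i i' : w.Tile} {c c' : Fin w.Cin} {q q' : Fin w.e × Fin w.e}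
    (h : windowVertex T i c (w.core hr q) = windowVertex T i' c' (w.core hr q')) :
    i = i' ∧ c = c' ∧ q = q' := by
  have aux : ∀ {e x x' a a' : ℕ}, a < e → a' < e → e * x + a = e * x' + a' → x = x' ∧ a = a' := by
    intro e x x' a a' ha ha' h
    have hd := congrArg (· / e) h
    have hm := congrArg (· % e) h
    simp only [Nat.mul_add_div (by omega : e > 0), Nat.mul_add_mod, Nat.div_eq_of_lt ha,
      Nat.div_eq_of_lt ha', Nat.mod_eq_of_lt ha, Nat.mod_eq_of_lt ha'] at hd hm
    exact ⟨hd, hm⟩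
  injection h with h1 h2 h3
  obtain ⟨hx, ha⟩ := aux q.1.2 q'.1.2 (congrArg Fin.val h1)
  obtain ⟨hy, hb⟩ := aux q.2.2 q'.2.2 (congrArg Fin.val h2)
  exact ⟨Prod.ext (Fin.ext hx) (Fin.ext hy), h3, Prod.ext (Fin.ext ha) (Fin.ext hb)⟩

/-- The number of products in one phase, when every output has its own transforms. -/
theorem card_independent_products_le {w : Params} {T : Trees w (Fin w.Cout) w.Tile}
    (hr : 0 < w.r) {N : ℕ} {D E : Finset (Vertex w T)} (hD : D.card ≤ N) (hE : E.card ≤ N)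
    (W : Finset ((w.Tile × (Fin w.e × Fin w.e)) × Fin w.Cout × Fin w.Cin))
    (hW : ∀ x ∈ W, Covered (independentGraph w T)
      (resultTrees T x.1.1 x.2.1 (w.core hr x.1.2) x.1.2) (D, E)
      (.sumT x.1.1 x.2.1 (w.core hr x.1.2) ((T.sumT x.1.1 x.2.1 (w.core hr x.1.2)).leaf x.2.2))) :
    ∃ b c, W.card = b + c ∧ b ≤ N ∧ (c * w.r) ^ 2 ≤ N ^ 3 := by
  classical
  -- All these trees are private to one pair `(i, k)`, so each vertex of `D` spoils at most one
  -- product.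
  let R : (w.Tile × (Fin w.e × Fin w.e)) × Fin w.Cout × Fin w.Cin → Vertex w T → Prop :=
    fun x d => d = .sumT x.1.1 x.2.1 (w.core hr x.1.2)
        ((T.sumT x.1.1 x.2.1 (w.core hr x.1.2)).leaf x.2.2) ∨
      (∃ s, d = .inT x.1.1 x.2.1 x.2.2 (w.core hr x.1.2) s) ∨
      ∃ s, d = .kerT x.2.1 x.1.1 x.2.2 (w.core hr x.1.2) s
  let bad : (w.Tile × (Fin w.e × Fin w.e)) × Fin w.Cout × Fin w.Cin → Prop := fun x =>
    ∃ d ∈ D, R x d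
  let W' := W.filter fun x => ¬ bad x
  have hgood : ∀ x ∈ W', (∀ a, windowVertex T x.1.1 x.2.2 a ∈ D) ∧
      ∀ a, .ker x.2.1 x.2.2 a ∈ D := by
    intro x hx
    obtain ⟨hxW, hx⟩ := Finset.mem_filter.1 hx
    rcases (product_of_covered (hW x hxW)).1 with h | ⟨h1, h2⟩
    · exact absurd ⟨_, h, .inl rfl⟩ hx
    · refine ⟨h1.resolve_left ?_, h2.resolve_left ?_⟩
      · rintro ⟨s, hs⟩
        exact hx ⟨_, hs, .inr (.inl ⟨s, rfl⟩)⟩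
      · rintro ⟨s, hs⟩
        exact hx ⟨_, hs, .inr (.inr ⟨s, rfl⟩)⟩
  have hout := fun x (hx : x ∈ W') => (product_of_covered (hW x (Finset.mem_filter.1 hx).1)).2
  refine ⟨(W.filter bad).card, W'.card, (Finset.card_filter_add_card_filter_not _).symm,
    le_trans ?_ hD, ?_⟩
  · refine Finset.card_le_of_relation _ _ R (fun x hx => (Finset.mem_filter.1 hx).2) ?_
    rintro ⟨⟨i, q⟩, k, c⟩ ⟨⟨i', q'⟩, k', c'⟩ d h h'
    have hc := @Params.core_injective w hr q q'
    simp only [R] at h h'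
    rcases h with rfl | ⟨s, rfl⟩ | ⟨s, rfl⟩ <;> rcases h' with h' | ⟨s', h'⟩ | ⟨s', h'⟩ <;>
      try cases h'
    · injection h' with h1 h2 h3 h4
      obtain rfl := hc h3
      subst h1 h2
      have h5 := congrArg Subtype.val (eq_of_heq h4)
      injection h5 with h5
      subst h5
      rfl
    · injection h' with h1 h2 h3 h4
      obtain rfl := hc h4
      subst h1 h2 h3
      rfl
    · injection h' with h1 h2 h3 h4
      obtain rfl := hc h4
      subst h1 h2 h3
      rfl
  · have hK : (W'.image fun x => (x.1, x.2.1)).card ≤ N := by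
      refine le_trans (Finset.card_le_of_relation _ E
        (fun x v => v ∈ resultTrees T x.1.1 x.2 (w.core hr x.1.2) x.1.2) ?_ ?_) hE
      · intro y hy
        obtain ⟨x, hx, rfl⟩ := Finset.mem_image.1 hy
        exact hout x hx
      · rintro ⟨⟨i, q⟩, k⟩ ⟨⟨i', q'⟩, k'⟩ v h h'
        obtain ⟨rfl, rfl, hq⟩ := resultTrees_disjoint h h'
        obtain rfl : q = q' := hq.elim (fun h => w.core_injective hr h) id
        rfl
    have hA : (W'.image fun x => (x.1, x.2.2)).card ≤ N := by
      refine le_trans (Finset.card_le_of_relation _ D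
        (fun x v => v = windowVertex T x.1.1 x.2 (w.core hr x.1.2)) ?_ ?_) hD
      · intro y hy
        obtain ⟨x, hx, rfl⟩ := Finset.mem_image.1 hy
        exact ⟨_, (hgood x hx).1 _, rfl⟩
      · rintro ⟨⟨i, q⟩, c⟩ ⟨⟨i', q'⟩, c'⟩ v rfl h'
        obtain ⟨rfl, rfl, rfl⟩ := windowVertex_core_injective T hr h'
        rfl
    -- Each pair `(k, c)` occupies `r²` elements of `D`: the source of the gain `r`.
    have hB : (W'.image fun x => x.2).card * (w.r * w.r) ≤ N := by
      have h := Finset.card_le_of_relation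
        ((W'.image fun x => x.2) ×ˢ (Finset.univ : Finset (Fin w.r × Fin w.r))) D
        (fun x v => v = .ker x.1.1 x.1.2 x.2) ?_ ?_
      · rw [Finset.card_product, Finset.card_univ, Fintype.card_prod, Fintype.card_fin] at h
        exact h.trans hD
      · rintro ⟨y, a⟩ hy
        obtain ⟨x, hx, rfl⟩ := Finset.mem_image.1 (Finset.mem_product.1 hy).1
        exact ⟨_, (hgood x hx).2 a, rfl⟩
      · rintro ⟨⟨k, c⟩, a⟩ ⟨⟨k', c'⟩, a'⟩ v rfl h'
        injection h' with h1 h2 h3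
        exact Prod.ext (Prod.ext h1 h2) h3
    have hLW := Finset.card_sq_le_of_projections W' _ _ _
      (fun x hx => Finset.mem_image_of_mem (fun x => (x.1, x.2.1)) hx)
      (fun x hx => Finset.mem_image_of_mem (fun x => (x.1, x.2.2)) hx)
      (fun x hx => Finset.mem_image_of_mem (fun x => x.2) hx)
    calc (W'.card * w.r) ^ 2 = W'.card ^ 2 * (w.r * w.r) := by ring
      _ ≤ _ := Nat.mul_le_mul_right _ hLW
      _ = (W'.image fun x => (x.1, x.2.1)).card * ((W'.image fun x => (x.1, x.2.2)).card *
          ((W'.image fun x => x.2).card * (w.r * w.r))) := by ring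
      _ ≤ N * (N * N) := Nat.mul_le_mul hK (Nat.mul_le_mul hA hB)
      _ = N ^ 3 := by ring

/-- The number of multiplications of window entries by coefficients in one phase that is too small
to hold a whole window, when every output has its own transforms. -/
theorem card_window_products_le {w : Params} {T : Trees w (Fin w.Cout) w.Tile}
    {N : ℕ} {D E : Finset (Vertex w T)} (hD : D.card ≤ N) (hE : E.card ≤ N)
    (hN : N < w.n * w.n) (q : Fin w.e × Fin w.e)
    (W : Finset ((w.Tile × Fin w.Cout × Fin w.Cin × w.Pos) × w.Pos))
    (hW : ∀ x ∈ W, Covered (independentGraph w T)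
      ({v | ∃ s, v = .inT x.1.1 x.1.2.1 x.1.2.2.1 x.1.2.2.2 s} ∪
        resultTrees T x.1.1 x.1.2.1 x.1.2.2.2 q) (D, E)
      (.inT x.1.1 x.1.2.1 x.1.2.2.1 x.1.2.2.2
        ((T.inT x.1.1 x.1.2.1 x.1.2.2.1 x.1.2.2.2).leaf x.2))) :
    W.card ≤ 3 * N ^ 2 := by
  classical
  have hwin : ∀ (i : w.Tile) (c : Fin w.Cin), ¬ ∀ a, windowVertex T i c a ∈ D := by
    intro i c h
    refine absurd (Finset.card_le_of_relation (Finset.univ : Finset w.Pos) D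
      (fun a v => v = windowVertex T i c a) (fun a _ => ⟨_, h a, rfl⟩) ?_) ?_
    · rintro ⟨a, b⟩ ⟨a', b'⟩ v rfl h'
      injection h' with h1 h2
      exact Prod.ext (Fin.ext (Nat.add_left_cancel (congrArg Fin.val h1)))
        (Fin.ext (Nat.add_left_cancel (congrArg Fin.val h2)))
    · rw [Finset.card_univ, Fintype.card_prod, Fintype.card_fin]
      omega
  have hcov := fun x hx => window_product_of_covered (f := id) (g := id) (hW x hx)
  let bad : (w.Tile × Fin w.Cout × Fin w.Cin × w.Pos) × w.Pos → Prop := fun x =>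
    .inT x.1.1 x.1.2.1 x.1.2.2.1 x.1.2.2.2
      ((T.inT x.1.1 x.1.2.1 x.1.2.2.1 x.1.2.2.2).leaf x.2) ∈ D
  let W' := W.filter fun x => ¬ bad x
  have hbad : (W.filter bad).card ≤ N := by
    refine (Finset.card_le_of_relation _ _ (fun x d => d = .inT x.1.1 x.1.2.1 x.1.2.2.1 x.1.2.2.2
      ((T.inT x.1.1 x.1.2.1 x.1.2.2.1 x.1.2.2.2).leaf x.2))
      (fun x hx => ⟨_, (Finset.mem_filter.1 hx).2, rfl⟩) ?_).trans hD
    rintro ⟨⟨i, k, c, p⟩, a⟩ ⟨⟨i', k', c', p'⟩, a'⟩ d rfl h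
    injection h with h1 h2 h3 h4 h5
    dsimp only at h1 h2 h3 h4
    subst h1 h2 h3 h4
    have h6 := congrArg Subtype.val (eq_of_heq h5)
    injection h6 with h6
    dsimp only at h6
    subst h6
    rfl
  -- No whole window lies in `D`, so every tree involved has a vertex in `D` or `E`.
  have htree : (W.image fun x => x.1).card ≤ N + N := by
    refine (Finset.card_le_of_relation _ (D ∪ E) (fun x v => ∃ s, v = .inT x.1 x.2.1 x.2.2.1
      x.2.2.2 s) ?_ ?_).trans ((Finset.card_union_le _ _).trans (add_le_add hD hE))
    · intro y hy
      obtain ⟨x, hx, rfl⟩ := Finset.mem_image.1 hy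
      rcases (hcov x hx).2 with ⟨s, hs⟩ | ⟨s, hs⟩ | h
      · exact ⟨_, Finset.mem_union_left _ hs, s, rfl⟩
      · exact ⟨_, Finset.mem_union_right _ hs, s, rfl⟩
      · exact absurd h (hwin _ _)
    · rintro ⟨i, k, c, p⟩ ⟨i', k', c', p'⟩ v ⟨s, rfl⟩ ⟨s', h⟩
      injection h with h1 h2 h3 h4
      dsimp only at h1 h2 h3 h4
      subst h1 h2 h3 h4
      rfl
  -- A window entry and a tree together determine the multiplication.
  have hgood : W'.card ≤ D.card * (W.image fun x => x.1).card := by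
    rw [← Finset.card_product]
    refine Finset.card_le_card_of_injOn
      (fun x => (windowVertex T x.1.1 x.1.2.2.1 x.2, x.1)) ?_ ?_
    · intro x hx
      obtain ⟨hxW, hx⟩ := Finset.mem_filter.1 (Finset.mem_coe.1 hx)
      exact Finset.mem_coe.2 (Finset.mem_product.2
        ⟨(hcov x hxW).1.resolve_left hx, Finset.mem_image_of_mem _ hxW⟩)
    · rintro ⟨y, a, b⟩ - ⟨y', a', b'⟩ - h
      obtain ⟨h, rfl⟩ := Prod.mk.inj h
      injection h with h1 h2
      have h1 := Fin.ext (Nat.add_left_cancel (congrArg Fin.val h1))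
      have h2 := Fin.ext (Nat.add_left_cancel (congrArg Fin.val h2))
      dsimp only at h1 h2
      rw [h1, h2]
  have hsum : (W.filter bad).card + W'.card = W.card := Finset.card_filter_add_card_filter_not _
  have hg : W'.card ≤ N * (N + N) := hgood.trans (Nat.mul_le_mul hD htree)
  have : N ≤ N ^ 2 := Nat.le_self_pow two_ne_zero N
  nlinarith

end Winograd

/-! ### The two lower bounds -/

namespace Winograd

open PebbleGame

/-- Every output of a block uses every position, so `p` and `q` are independent here. -/
theorem exists_covered_product {w : Params} {κ ν : Type} {f : Fin w.Cout → κ} {g : w.Tile → ν}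
    {T : Trees w κ ν} {h : ℕ} {D E : Fin h → Finset (Vertex w T)}
    (hcov : ∀ U : Set (Vertex w T), (∀ u ∈ U, u ∉ inputs (graph w f g T)) → ∀ o ∈ U,
      o ∈ outputs (graph w f g T) → ∀ v, Walk (graph w f g T) U v o →
        ∃ m, Covered (graph w f g T) U (D m, E m) v)
    (i : w.Tile) (k : Fin w.Cout) (p : w.Pos) (q : Fin w.e × Fin w.e)
    (s : (T.sumT i k p).Vertex) :
    ∃ m, Covered (graph w f g T) (resultTrees T i k p q) (D m, E m) (.sumT i k p s) :=
  hcov _ (fun _ hu => notMem_inputs_of_mem_resultTrees hu) _ (.inr ⟨_, rfl⟩)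
    (outT_root_mem_outputs i k q) _ (walk_output subset_rfl _)

theorem exists_covered_window_product {w : Params} {κ ν : Type} {f : Fin w.Cout → κ}
    {g : w.Tile → ν} {T : Trees w κ ν} {h : ℕ} {D E : Fin h → Finset (Vertex w T)}
    (hcov : ∀ U : Set (Vertex w T), (∀ u ∈ U, u ∉ inputs (graph w f g T)) → ∀ o ∈ U,
      o ∈ outputs (graph w f g T) → ∀ v, Walk (graph w f g T) U v o →
        ∃ m, Covered (graph w f g T) U (D m, E m) v)
    (i : w.Tile) (k : Fin w.Cout) (c : Fin w.Cin) (p : w.Pos) (q : Fin w.e × Fin w.e)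
    (s : (T.inT i (f k) c p).Vertex) :
    ∃ m, Covered (graph w f g T) ({v | ∃ s, v = .inT i (f k) c p s} ∪ resultTrees T i k p q)
      (D m, E m) (.inT i (f k) c p s) := by
  refine hcov _ ?_ _ (.inr (.inr ⟨_, rfl⟩)) (outT_root_mem_outputs i k q) _
    (((walk_root _ _ (adj_inT i (f k) c p) (fun s => .inl ⟨s, rfl⟩) s).tail
      ⟨adj_inT_sumT i k c p, .inl ⟨_, rfl⟩, .inr (.inl ⟨_, rfl⟩)⟩).trans
        (walk_output Set.subset_union_right _))
  rintro u (⟨s, rfl⟩ | hu)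
  · exact inT_notMem_inputs _ _ _ _ _
  · exact notMem_inputs_of_mem_resultTrees hu

theorem Params.Admissible.card_tile {w : Params} (hw : w.Admissible) :
    Fintype.card w.Tile * (w.e * w.e) = w.Wout * w.Hout := by
  rw [Fintype.card_prod, Fintype.card_fin, Fintype.card_fin, mul_mul_mul_comm,
    Nat.div_mul_cancel hw.e_dvd_Wout, Nat.div_mul_cancel hw.e_dvd_Hout]

theorem independent_lower_bound {w : Params} (hw : w.Admissible)
    (T : Trees w (Fin w.Cout) w.Tile) {S Q : ℕ} (hS : 0 < S)
    (hQ : CompleteCalculation (independentGraph w T) S Q) :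
    (w.Wout * w.Hout * w.Cout * w.Cin : ℝ) * w.r ≤ 20 * (Q * √S) := by
  obtain ⟨X, h, D, E, hXS, hhX, hcard, hcov⟩ := hQ.exists_phases hS
  have hr := hw.r_pos
  have he := hw.e_pos
  have htile := hw.card_tile
  have hQS : (0 : ℝ) ≤ Q * √S := by positivity
  -- If `n² ≤ 2 * X`, then `r² ≤ 2 * X`, and the spoiled products are absorbed in the main term.
  -- Otherwise no window fits into `D`.
  rcases le_or_gt (w.n * w.n) (2 * X) with hn | hn
  · have key := Fintype.card_mul_le_of_cover (Nat.cast_nonneg w.r)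
      (F := 2 * ((2 * X : ℕ) * √(2 * X : ℕ)))
      (fun m => {x : (w.Tile × (Fin w.e × Fin w.e)) × Fin w.Cout × Fin w.Cin |
        Covered (independentGraph w T)
          (resultTrees T x.1.1 x.2.1 (w.core hr x.1.2) x.1.2) (D m, E m)
          (.sumT x.1.1 x.2.1 (w.core hr x.1.2)
            ((T.sumT x.1.1 x.2.1 (w.core hr x.1.2)).leaf x.2.2))})
      (fun x => exists_covered_product hcov _ _ _ _ _) ?_
    · have hc : Fintype.card ((w.Tile × (Fin w.e × Fin w.e)) × Fin w.Cout × Fin w.Cin)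
          = w.Wout * w.Hout * w.Cout * w.Cin := by
        rw [Fintype.card_prod, Fintype.card_prod, Fintype.card_prod (Fin w.e),
          Fintype.card_prod (Fin w.Cout)]
        simp only [Fintype.card_fin]
        rw [htile, mul_assoc, mul_assoc, mul_assoc]
      rw [hc] at key
      push_cast at key
      have := mul_mul_sqrt_le hXS hhX
      push_cast at this
      linarith
    · intro m A hA
      obtain ⟨b, c, hbc, hb, hc⟩ :=
        card_independent_products_le hr (hcard m).1 (hcard m).2 A hA
      rw [hbc]
      refine add_mul_le_of_sq_le hb (le_trans ?_ hn) hc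
      have : w.r ≤ w.n := by simp only [Params.n]; omega
      rw [sq]
      exact Nat.mul_le_mul this this
  · have key := Fintype.card_mul_le_of_cover zero_le_one (F := (3 * (2 * X) ^ 2 : ℕ))
      (fun m => {x : (w.Tile × Fin w.Cout × Fin w.Cin × w.Pos) × w.Pos |
        Covered (independentGraph w T)
          ({v | ∃ s, v = .inT x.1.1 x.1.2.1 x.1.2.2.1 x.1.2.2.2 s} ∪
            resultTrees T x.1.1 x.1.2.1 x.1.2.2.2 (⟨0, he⟩, ⟨0, he⟩)) (D m, E m)
          (.inT x.1.1 x.1.2.1 x.1.2.2.1 x.1.2.2.2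
            ((T.inT x.1.1 x.1.2.1 x.1.2.2.1 x.1.2.2.2).leaf x.2))})
      (fun x => exists_covered_window_product hcov _ _ _ _ _ _) ?_
    · have hc : Fintype.card ((w.Tile × Fin w.Cout × Fin w.Cin × w.Pos) × w.Pos)
          = Fintype.card w.Tile * (w.n * w.n) * w.Cout * w.Cin * (w.n * w.n) := by
        rw [Fintype.card_prod, Fintype.card_prod w.Tile, Fintype.card_prod (Fin w.Cout),
          Fintype.card_prod (Fin w.Cin), Fintype.card_prod (Fin w.n)]
        simp only [Fintype.card_fin]
        ring
      have hen : w.e ≤ w.n := by simp only [Params.n]; omega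
      have hrn : w.r ≤ w.n := by simp only [Params.n]; omega
      have hle : w.Wout * w.Hout * w.Cout * w.Cin * (w.n * w.n) ≤
          Fintype.card ((w.Tile × Fin w.Cout × Fin w.Cin × w.Pos) × w.Pos) := by
        rw [hc, ← htile]
        gcongr
      rw [mul_one, ← Nat.cast_mul, Nat.cast_le] at key
      have h1 : w.Wout * w.Hout * w.Cout * w.Cin * (w.n * w.n) ≤ 24 * Q * X := by
        calc _ ≤ h * (3 * (2 * X) ^ 2) := hle.trans key
          _ = 12 * (h * X) * X := by ring
          _ ≤ 12 * (2 * Q) * X := by gcongr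
          _ = 24 * Q * X := by ring
      have h2 : (w.Wout * w.Hout * w.Cout * w.Cin * (w.n * w.n) : ℝ) ≤ 24 * Q * X := by
        exact_mod_cast h1
      have hn0 : (0 : ℝ) < w.n := by exact_mod_cast lt_of_lt_of_le hr hrn
      -- From `X ≤ n² / 2` and `1 / 2 ≤ (3 / 4) ^ 2`.
      have hXn : √(X : ℝ) ≤ 3 / 4 * w.n := by
        rw [Real.sqrt_le_left (by positivity)]
        have : (2 * X : ℝ) ≤ w.n * w.n := by exact_mod_cast hn.le
        nlinarith
      have hXS' : √(X : ℝ) ≤ √S := Real.sqrt_le_sqrt (by exact_mod_cast hXS)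
      have hX : (X : ℝ) ≤ √S * (3 / 4 * w.n) := by
        calc (X : ℝ) = √X * √X := (Real.mul_self_sqrt (Nat.cast_nonneg _)).symm
          _ ≤ _ := by gcongr
      have h3 : (w.Wout * w.Hout * w.Cout * w.Cin : ℝ) * w.n ≤ 20 * (Q * √S) := by
        refine le_of_mul_le_mul_right ?_ hn0
        calc (w.Wout * w.Hout * w.Cout * w.Cin : ℝ) * w.n * w.n
            = w.Wout * w.Hout * w.Cout * w.Cin * (w.n * w.n) := by ring
          _ ≤ 24 * Q * X := h2
          _ ≤ 24 * Q * (√S * (3 / 4 * w.n)) := by gcongr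
          _ = 18 * (Q * √S) * w.n := by ring
          _ ≤ 20 * (Q * √S) * w.n := by gcongr; norm_num
      refine le_trans ?_ h3
      gcongr
    · intro m A hA
      rw [mul_one, Nat.cast_le]
      exact card_window_products_le (hcard m).1 (hcard m).2 hn _ A hA

/-- A single position already gives the right order for fixed `e` and `r`; the factor `e²` passes
from tiles to output entries. -/
theorem shared_lower_bound {w : Params} (hw : w.Admissible) (T : Trees w Unit Unit) {S Q : ℕ}
    (hS : 0 < S) (hQ : CompleteCalculation (sharedGraph w T) S Q) :
    (w.Wout * w.Hout * w.Cout * w.Cin : ℝ) ≤ 12 * (w.e * w.e) * (Q * √S) := by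
  obtain ⟨X, h, D, E, hXS, hhX, hcard, hcov⟩ := hQ.exists_phases hS
  have hr := hw.r_pos
  have he := hw.e_pos
  have hn : 0 < w.n := by simp only [Params.n]; omega
  have key := Fintype.card_mul_le_of_cover (zero_le_one' ℝ)
    (F := 2 * ((2 * X : ℕ) * √(2 * X : ℕ)))
    (fun m => {x : w.Tile × Fin w.Cout × Fin w.Cin |
      Covered (sharedGraph w T)
        (resultTrees T x.1 x.2.1 (⟨0, hn⟩, ⟨0, hn⟩) (⟨0, he⟩, ⟨0, he⟩)) (D m, E m)
        (.sumT x.1 x.2.1 (⟨0, hn⟩, ⟨0, hn⟩)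
          ((T.sumT x.1 x.2.1 (⟨0, hn⟩, ⟨0, hn⟩)).leaf x.2.2))})
    (fun x => exists_covered_product hcov _ _ _ _ _) ?_
  · have hc : w.Wout * w.Hout * w.Cout * w.Cin =
        w.e * w.e * Fintype.card (w.Tile × Fin w.Cout × Fin w.Cin) := by
      rw [← hw.card_tile, Fintype.card_prod w.Tile, Fintype.card_prod (Fin w.Cout)]
      simp only [Fintype.card_fin]
      ring
    have hc' : (w.Wout * w.Hout * w.Cout * w.Cin : ℝ) =
        w.e * w.e * Fintype.card (w.Tile × Fin w.Cout × Fin w.Cin) := by exact_mod_cast hc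
    rw [hc']
    calc _ ≤ (w.e * w.e : ℝ) * (12 * (Q * √S)) := by
          gcongr
          linarith [mul_mul_sqrt_le hXS hhX]
      _ = _ := by ring
  · intro m A hA
    obtain ⟨b, c, hbc, hb, hc⟩ := card_products_le hr _ _ (hcard m).1 (hcard m).2 A hA
    rw [hbc]
    -- `add_mul_le_of_sq_le` with `r = 1` requires `1 ≤ 2 * X`.
    rcases Nat.eq_zero_or_pos (2 * X) with hX | hX
    · rw [hX] at hb hc ⊢
      have : c = 0 := by simpa using hc
      simp [this, Nat.le_zero.1 hb]
    · have := add_mul_le_of_sq_le (r := 1) hb (by omega) (by simpa using hc)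
      simpa using this

theorem bound_le_iff {w : Params} (hw : w.Admissible) {S : ℕ} (hS : 0 < S) {B : ℝ} :
    bound w S ≤ B ↔ (w.Wout : ℝ) * w.Hout * w.Cout * w.Cin * ((w.e : ℝ) + w.r - 1) * w.r ≤
      B * (w.e * √(S : ℝ)) := by
  have he : (0 : ℝ) < w.e := by exact_mod_cast hw.e_pos
  have hS' : (0 : ℝ) < √(S : ℝ) := Real.sqrt_pos.2 (by exact_mod_cast hS)
  rw [bound, div_le_iff₀ (by positivity)]

end Winograd

theorem mainTheorem4 :
    (∃ C : ℝ, 0 < C ∧ ∀ w : Winograd.Params, w.Admissible →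
      ∀ (T : Winograd.Trees w (Fin w.Cout) w.Tile) (S : ℕ), 0 < S →
      ∀ Q : ℕ, PebbleGame.CompleteCalculation (Winograd.independentGraph w T) S Q →
        C * Winograd.bound w S ≤ (Q : ℝ)) ∧
    (∀ e r : ℕ, ∃ C : ℝ, 0 < C ∧ ∀ w : Winograd.Params, w.Admissible → w.e = e → w.r = r →
      ∀ (T : Winograd.Trees w Unit Unit) (S : ℕ), 0 < S →
      ∀ Q : ℕ, PebbleGame.CompleteCalculation (Winograd.sharedGraph w T) S Q →
        C * Winograd.bound w S ≤ (Q : ℝ)) := by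
  -- `60 = 3 * 20`: `r ≤ 2 * e` gives `e + r - 1 ≤ 3 * e`, and `20` is from
  -- `independent_lower_bound`.
  refine ⟨⟨1 / 60, by norm_num, fun w hw T S hS Q hQ => ?_⟩, fun e r => ?_⟩
  · have h := Winograd.independent_lower_bound hw T hS hQ
    have he : (0 : ℝ) < w.e := by exact_mod_cast hw.e_pos
    have hn : (w.e : ℝ) + w.r - 1 ≤ 3 * w.e := by
      have := (div_le_iff₀ he).1 hw.le_two
      linarith
    suffices Winograd.bound w S ≤ 60 * Q by linarith
    rw [Winograd.bound_le_iff hw hS]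
    calc (w.Wout : ℝ) * w.Hout * w.Cout * w.Cin * ((w.e : ℝ) + w.r - 1) * w.r
        ≤ w.Wout * w.Hout * w.Cout * w.Cin * (3 * w.e) * w.r := by gcongr
      _ = 3 * w.e * (w.Wout * w.Hout * w.Cout * w.Cin * w.r) := by ring
      _ ≤ 3 * w.e * (20 * (Q * √S)) := by gcongr
      _ = 60 * Q * (w.e * √S) := by ring
  -- The `+ 1` keeps the constant positive when `e` or `r` is zero, where no parameters are
  -- admissible.
  · have hC : (0 : ℝ) < 12 * e * (e + r) * r + 1 := by positivity
    refine ⟨(12 * e * (e + r) * r + 1 : ℝ)⁻¹, inv_pos.2 hC, ?_⟩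
    rintro w hw rfl rfl T S hS Q hQ
    have h := Winograd.shared_lower_bound hw T hS hQ
    rw [inv_mul_le_iff₀ hC, Winograd.bound_le_iff hw hS]
    calc (w.Wout : ℝ) * w.Hout * w.Cout * w.Cin * ((w.e : ℝ) + w.r - 1) * w.r
        ≤ w.Wout * w.Hout * w.Cout * w.Cin * (w.e + w.r) * w.r := by
          gcongr
          linarith
      _ = (w.e + w.r) * w.r * (w.Wout * w.Hout * w.Cout * w.Cin) := by ring
      _ ≤ (w.e + w.r) * w.r * (12 * (w.e * w.e) * (Q * √S)) := by gcongr
      _ = 12 * w.e * (w.e + w.r) * w.r * Q * (w.e * √S) := by ring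
      _ ≤ (12 * w.e * (w.e + w.r) * w.r + 1) * Q * (w.e * √S) := by
          gcongr
          linarith
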